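/- Let \(\mathbb{H}^2\) be the oriented hyperbolic plane and let \(\mathrm{Isom}^+(\mathbb{H}^2)\) be its group of orientation preserving isometries, with the topology of pointwise convergence. Fix a point \(p_0\in\mathbb{H}^2\) and a unit tangent vector \(v\in T_{p_0}\mathbb{H}^2\). Let \(R\) be the clockwise rotation by a right angle fixing \(p_0\), for \(r>0\) let \(A_r\) be the translation of distance \(r\) along the geodesic with initial condition \(v\), in the direction of \(v\), and let \(G_r\) be the subgroup of \(\mathrm{Isom}^+(\mathbb{H}^2)\) generated by \(R\) and \(A_r\). For \(t>4\) put \[ r_t=\operatorname{arcosh}\left(1+2\cos\left(\frac{2\pi}{t}\right)\right). \] If \(t=p/q>4\), where \(p\) and \(q\) are coprime positive integers and \(q>1\), then \(G_{r_t}\) is dense in \(\mathrm{Isom}^+(\mathbb{H}^2)\). -/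

import Mathlib

open scoped UpperHalfPlane MatrixGroups

noncomputable section

namespace HypPlane

open UpperHalfPlane

/-- A self-map of the upper half-plane read in the global coordinate `ℍ ⊆ ℂ`
(only its germs at points of the half-plane matter). -/
def inCoord (f : ℍ → ℍ) : ℂ → ℂ := fun w => (f (ofComplex w) : ℂ)

/-- A map `ℍ → ℍ` preserves the orientation if its real differential has positive determinant
at every point. (Since `fderiv` is `0` where the map is not differentiable, this includes
differentiability.) -/
def OrientationPreserving (f : ℍ → ℍ) : Prop :=
  ∀ z : ℍ, 0 < (fderiv ℝ (inCoord f) (z : ℂ)).det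

theorem det_zero_clm : (0 : ℂ →L[ℝ] ℂ).det = 0 := by
  simp [ContinuousLinearMap.det]

theorem OrientationPreserving.differentiableAt {f : ℍ → ℍ} (hf : OrientationPreserving f)
    (z : ℍ) : DifferentiableAt ℝ (inCoord f) (z : ℂ) := by
  by_contra h
  have := hf z
  rw [fderiv_zero_of_not_differentiableAt h, det_zero_clm] at this
  exact lt_irrefl _ this

theorem inCoord_coe (f : ℍ → ℍ) (z : ℍ) : inCoord f (z : ℂ) = f z := by
  simp [inCoord, ofComplex_apply]

theorem inCoord_comp (f g : ℍ → ℍ) : inCoord (f ∘ g) = inCoord f ∘ inCoord g := by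
  funext w
  simp [inCoord, ofComplex_apply]

theorem inCoord_id_eventuallyEq (z : ℍ) : inCoord id =ᶠ[nhds (z : ℂ)] id := by
  filter_upwards [isOpen_upperHalfPlaneSet.mem_nhds z.im_pos] with w hw
  have : inCoord id ((⟨w, hw⟩ : ℍ) : ℂ) = _ := inCoord_coe id ⟨w, hw⟩
  simpa using this

theorem hasFDerivAt_inCoord_id (z : ℍ) :
    HasFDerivAt (inCoord id) (ContinuousLinearMap.id ℝ ℂ) (z : ℂ) :=
  (hasFDerivAt_id (z : ℂ)).congr_of_eventuallyEq (inCoord_id_eventuallyEq z)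

theorem orientationPreserving_id : OrientationPreserving id := by
  intro z
  rw [(hasFDerivAt_inCoord_id z).fderiv]
  simp [ContinuousLinearMap.det]

theorem fderiv_inCoord_comp {f g : ℍ → ℍ} {z : ℍ}
    (hf : DifferentiableAt ℝ (inCoord f) (g z : ℂ)) (hg : DifferentiableAt ℝ (inCoord g) (z : ℂ)) :
    fderiv ℝ (inCoord (f ∘ g)) (z : ℂ) =
      (fderiv ℝ (inCoord f) (g z : ℂ)).comp (fderiv ℝ (inCoord g) (z : ℂ)) := by
  rw [inCoord_comp, fderiv_comp _ (by rwa [inCoord_coe]) hg, inCoord_coe]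

theorem OrientationPreserving.comp {f g : ℍ → ℍ} (hf : OrientationPreserving f)
    (hg : OrientationPreserving g) : OrientationPreserving (f ∘ g) := by
  intro z
  rw [fderiv_inCoord_comp (hf.differentiableAt _) (hg.differentiableAt _)]
  have : ∀ A B : ℂ →L[ℝ] ℂ, (A.comp B).det = A.det * B.det := fun A B => by
    simp [ContinuousLinearMap.det, LinearMap.det_comp]
  rw [this]
  exact mul_pos (hf _) (hg _)

theorem OrientationPreserving.symm {g : ℍ ≃ᵢ ℍ} (hg : OrientationPreserving g) :
    OrientationPreserving g.symm := by
  intro z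
  have hd := hg (g.symm z)
  set L := fderiv ℝ (inCoord g) (g.symm z : ℂ) with hL
  have hfd : HasFDerivAt (inCoord g)
      (L.toContinuousLinearEquivOfDetNeZero hd.ne' : ℂ →L[ℝ] ℂ) (inCoord g.symm z) := by
    rw [inCoord_coe, ContinuousLinearMap.coe_toContinuousLinearEquivOfDetNeZero]
    exact (hg.differentiableAt _).hasFDerivAt
  have hcont : ContinuousAt (inCoord g.symm) (z : ℂ) := by
    have h1 : ContinuousAt (fun w : ℂ => (ofComplex w : ℍ)) (z : ℂ) :=
      (contMDiffAt_ofComplex (n := 0) z.im_pos).continuousAt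
    exact (UpperHalfPlane.continuous_coe.comp g.symm.continuous).continuousAt.comp h1
  have hinv : ∀ᶠ y in nhds (z : ℂ), inCoord g (inCoord g.symm y) = y := by
    filter_upwards [inCoord_id_eventuallyEq z] with y hy
    have : (g ∘ g.symm : ℍ → ℍ) = id := by ext; simp
    rw [← Function.comp_apply (f := inCoord g), ← inCoord_comp, this, hy, id]
  have hder := hfd.of_local_left_inverse hcont hinv
  have hsymm : DifferentiableAt ℝ (inCoord g.symm) (z : ℂ) := hder.differentiableAt
  have hcomp := fderiv_inCoord_comp (f := g) (g := g.symm) (z := z)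
    (hg.differentiableAt _) hsymm
  have hid : (g ∘ g.symm : ℍ → ℍ) = id := by ext; simp
  rw [hid, (hasFDerivAt_inCoord_id z).fderiv, ← hL] at hcomp
  have hdet := congrArg ContinuousLinearMap.det hcomp
  have hmul : ∀ A B : ℂ →L[ℝ] ℂ, (A.comp B).det = A.det * B.det := fun A B => by
    simp [ContinuousLinearMap.det, LinearMap.det_comp]
  rw [hmul] at hdet
  have h1 : (ContinuousLinearMap.id ℝ ℂ).det = 1 := by simp [ContinuousLinearMap.det]
  rw [h1] at hdet
  exact pos_of_mul_pos_right (by rw [← hdet]; exact one_pos) hd.le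

/-- `Isom⁺(ℍ²)`: the group of orientation preserving isometries of the hyperbolic plane, in the
upper half-plane model. -/
def IsomPlus : Subgroup (ℍ ≃ᵢ ℍ) where
  carrier := {g | OrientationPreserving g}
  mul_mem' {f g} hf hg := OrientationPreserving.comp (f := f) (g := g) hf hg
  one_mem' := orientationPreserving_id
  inv_mem' {g} hg := OrientationPreserving.symm (g := g) hg

/-- The topology of pointwise convergence on `Isom⁺(ℍ²)`. -/
instance : TopologicalSpace IsomPlus :=
  TopologicalSpace.induced (fun (g : IsomPlus) (z : ℍ) => (g : ℍ ≃ᵢ ℍ) z) inferInstance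

theorem hasDerivAt_smul (M : SL(2, ℝ)) (z : ℍ) :
    HasDerivAt (inCoord (fun w => M • w)) (1 / denom M z ^ 2) (z : ℂ) := by
  have := (hasStrictDerivAt_smul (g := (M : GL (Fin 2) ℝ)) (by simp) z).hasDerivAt
  simpa using! this

theorem denom_SL (M : SL(2, ℝ)) (z : ℂ) : denom M z = (M 1 0 : ℂ) * z + (M 1 1 : ℂ) := rfl

theorem orientationPreserving_smul (M : SL(2, ℝ)) :
    OrientationPreserving (fun w => M • w) := by
  intro z
  have := (hasStrictFDerivAt_smul (M : GL (Fin 2) ℝ) z).hasFDerivAt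
  have h2 : fderiv ℝ (inCoord (fun w => M • w)) (z : ℂ) = smulFDeriv (M : GL (Fin 2) ℝ) z :=
    this.fderiv
  rw [h2, det_smulFDeriv]
  simp [denom_ne_zero]

/-- The isometry `z ↦ (a z + b) / (c z + d)` given by a real matrix of determinant `1`. -/
def moebius : SL(2, ℝ) →* IsomPlus where
  toFun M := ⟨IsometryEquiv.constSMul M, orientationPreserving_smul M⟩
  map_one' := by ext z; simp
  map_mul' M N := by ext z; simp [mul_smul]

/-- The matrix of the clockwise rotation of angle `α` fixing `i`. -/
def rotMatrix (α : ℝ) : SL(2, ℝ) :=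
  ⟨!![Real.cos (α / 2), -Real.sin (α / 2); Real.sin (α / 2), Real.cos (α / 2)], by
    rw [Matrix.det_fin_two_of]; nlinarith [Real.sin_sq_add_cos_sq (α / 2)]⟩

/-- The matrix of the translation of distance `r` upwards along the imaginary axis. -/
def transMatrix (r : ℝ) : SL(2, ℝ) :=
  ⟨!![Real.exp (r / 2), 0; 0, Real.exp (-(r / 2))], by
    rw [Matrix.det_fin_two_of, ← Real.exp_add]; simp⟩

/-- An orientation preserving isometry that takes the base point `i` with the upward unit vector
to the point `p` with the direction of `v ∈ T_p ℍ² = ℂ`: rotate at `i` from the upward direction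
clockwise by `π / 2 - arg v`, then move `i` to `p` by `z ↦ (im p) z + re p`. -/
def frame (p : ℍ) (v : ℂ) : SL(2, ℝ) := p.toSL2R * rotMatrix (Real.pi / 2 - v.arg)

/-- The clockwise rotation of angle `α` about `p`. -/
def rotation (p : ℍ) (α : ℝ) : IsomPlus :=
  moebius (p.toSL2R * rotMatrix α * p.toSL2R⁻¹)

/-- The translation of distance `r` along the oriented geodesic through `p` in direction `v`. -/
def translation (p : ℍ) (v : ℂ) (r : ℝ) : IsomPlus :=
  moebius (frame p v * transMatrix r * (frame p v)⁻¹)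

/-- The unit speed geodesic with initial condition `(p, v)`, where `v` is a unit vector at `p`. -/
def geodesic (p : ℍ) (v : ℂ) (s : ℝ) : ℍ := frame p v • (⟨⟨0, Real.exp s⟩, Real.exp_pos s⟩ : ℍ)

/-- The group `G_r` generated by the clockwise right-angle rotation `R` about `p` and the
translation `A_r` of distance `r` along the geodesic with initial condition `v ∈ T_p ℍ²`. -/
def robotGroup (p : ℍ) (v : ℂ) (r : ℝ) : Subgroup IsomPlus :=
  Subgroup.closure {rotation p (Real.pi / 2), translation p v r}

/-- `r_t = arcosh (1 + 2 cos (2π / t))`. -/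
def sideLength (t : ℝ) : ℝ := Real.arcosh (1 + 2 * Real.cos (2 * Real.pi / t))

/-! The defining properties of the rotation, the geodesic and the translation. -/

theorem rotMatrix_smul_I (α : ℝ) : rotMatrix α • (I : ℍ) = I := by
  have h := denom_ne_zero (rotMatrix α : GL (Fin 2) ℝ) I
  ext
  rw [coe_specialLinearGroup_apply]
  have h' : (Complex.sin (α / 2) * Complex.I + Complex.cos (α / 2)) ≠ 0 := by
    rw [denom_SL] at h
    simpa [rotMatrix] using h
  simp only [rotMatrix]
  simp
  rw [div_eq_iff h']
  linear_combination (-Complex.sin (α / 2)) * Complex.I_sq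

theorem rotation_apply_self (p : ℍ) (α : ℝ) : (rotation p α : ℍ ≃ᵢ ℍ) p = p := by
  have h : p.toSL2R⁻¹ • p = I := by rw [inv_smul_eq_iff, toSL2R_smul_I]
  change (p.toSL2R * rotMatrix α * p.toSL2R⁻¹) • p = p
  rw [mul_smul, mul_smul, h, rotMatrix_smul_I, toSL2R_smul_I]

theorem hasDerivAt_mul_smul {M N : SL(2, ℝ)} {z : ℍ} {a b : ℂ}
    (hM : HasDerivAt (inCoord (fun w => M • w)) a ((N • z : ℍ) : ℂ))
    (hN : HasDerivAt (inCoord (fun w => N • w)) b (z : ℂ)) :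
    HasDerivAt (inCoord (fun w => (M * N) • w)) (a * b) (z : ℂ) := by
  have h : (fun w : ℍ => (M * N) • w) = (fun w => M • w) ∘ (fun w => N • w) := by
    ext w; simp [mul_smul]
  rw [h, inCoord_comp]
  exact HasDerivAt.comp _ (by rwa [inCoord_coe]) hN

theorem hasDerivAt_rotMatrix (α : ℝ) :
    HasDerivAt (inCoord (fun w => rotMatrix α • w)) (Complex.exp (-(α * Complex.I)))
      ((I : ℍ) : ℂ) := by
  have h := hasDerivAt_smul (rotMatrix α) I
  have hd : denom (rotMatrix α) (I : ℍ) = Complex.exp (α / 2 * Complex.I) := by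
    rw [Complex.exp_mul_I, denom_SL]
    simp [rotMatrix]
    ring
  rw [hd, ← Complex.exp_nat_mul, one_div, ← Complex.exp_neg] at h
  convert h using 2
  push_cast
  ring

theorem hasDerivAt_toSL2R (p z : ℍ) :
    HasDerivAt (inCoord (fun w => p.toSL2R • w)) (p.im : ℂ) (z : ℂ) := by
  have h := hasDerivAt_smul p.toSL2R z
  have hd : 1 / denom p.toSL2R z ^ 2 = (p.im : ℂ) := by
    have h2 : ((√p.im : ℝ) : ℂ) ^ 2 = (p.im : ℂ) := by
      rw [← Complex.ofReal_pow, Real.sq_sqrt p.im_pos.le]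
    rw [denom_SL]
    simp [toSL2R_apply, h2]
  rwa [hd] at h

/-- `rotation p α` acts on the tangent space at `p` as the clockwise rotation of angle `α`. -/
theorem hasDerivAt_rotation (p : ℍ) (α : ℝ) :
    HasDerivAt (inCoord (rotation p α : ℍ ≃ᵢ ℍ)) (Complex.exp (-(α * Complex.I))) (p : ℂ) := by
  have h : p.toSL2R⁻¹ • p = I := by rw [inv_smul_eq_iff, toSL2R_smul_I]
  have hinv := hasDerivAt_smul p.toSL2R⁻¹ p
  set b := 1 / denom (p.toSL2R⁻¹ : SL(2, ℝ)) (p : ℂ) ^ 2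
  have hid := hasDerivAt_mul_smul (hasDerivAt_toSL2R p _) hinv
  have hb : (p.im : ℂ) * b = 1 := by
    refine hid.unique ?_
    have : (fun w : ℍ => (p.toSL2R * p.toSL2R⁻¹) • w) = id := by ext w; simp
    rw [this]
    exact (hasDerivAt_id (p : ℂ)).congr_of_eventuallyEq (inCoord_id_eventuallyEq p)
  have h1 := hasDerivAt_mul_smul (M := p.toSL2R) (N := rotMatrix α) (z := I)
    (hasDerivAt_toSL2R p _) (hasDerivAt_rotMatrix α)
  have h2 := hasDerivAt_mul_smul (M := p.toSL2R * rotMatrix α) (z := p) (by rw [h]; exact h1) hinv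
  convert! h2 using 1
  linear_combination (-Complex.exp (-(α * Complex.I))) * hb

theorem isometry_geodesic (p : ℍ) (v : ℂ) : Isometry (geodesic p v) :=
  (isometry_smul ℍ (frame p v)).comp (isometry_vertical_line 0)

theorem geodesic_zero (p : ℍ) (v : ℂ) : geodesic p v 0 = p := by
  have h : (⟨⟨0, Real.exp 0⟩, Real.exp_pos 0⟩ : ℍ) = I := by
    ext; apply Complex.ext <;> simp
  rw [geodesic, h, frame, mul_smul, rotMatrix_smul_I, toSL2R_smul_I]

theorem hasDerivAt_geodesic (p : ℍ) (v : ℂ) (hv : ‖v‖ = p.im) :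
    HasDerivAt (fun s : ℝ => (geodesic p v s : ℂ)) v 0 := by
  have h1 := hasDerivAt_mul_smul (M := p.toSL2R) (N := rotMatrix (Real.pi / 2 - v.arg)) (z := I)
    (hasDerivAt_toSL2R p _) (hasDerivAt_rotMatrix _)
  have h0 : HasDerivAt (fun s : ℝ => Complex.exp s * Complex.I) (Complex.I) (0 : ℝ) := by
    have := ((Complex.hasDerivAt_exp (0 : ℝ)).comp_ofReal).mul_const Complex.I
    simpa using this
  have hc := HasDerivAt.comp (0 : ℝ) (h₂ := inCoord (fun w => frame p v • w))
    (h := fun s : ℝ => Complex.exp s * Complex.I) (by simpa using! h1) h0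
  convert! hc using 1
  · funext s
    have : Complex.exp s * Complex.I =
        ((⟨⟨0, Real.exp s⟩, Real.exp_pos s⟩ : ℍ) : ℂ) := by
      apply Complex.ext <;> simp [← Complex.ofReal_exp]
    rw [Function.comp_apply, this, inCoord_coe]
    rfl
  · have h2 : Complex.exp (-(((Real.pi / 2 - v.arg : ℝ) : ℂ) * Complex.I)) * Complex.I =
        Complex.exp (v.arg * Complex.I) := by
      have : -(((Real.pi / 2 - v.arg : ℝ) : ℂ) * Complex.I) =
          v.arg * Complex.I - (Real.pi / 2) * Complex.I := by push_cast; ring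
      rw [this, Complex.exp_sub, Complex.exp_pi_div_two_mul_I, div_mul_cancel₀ _ Complex.I_ne_zero]
    push_cast at h2
    rw [mul_assoc, h2, ← hv, Complex.norm_mul_exp_arg_mul_I]

/-- `translation p v r` translates the geodesic with initial condition `(p, v)` by `r`. -/
theorem translation_geodesic (p : ℍ) (v : ℂ) (r s : ℝ) :
    (translation p v r : ℍ ≃ᵢ ℍ) (geodesic p v s) = geodesic p v (s + r) := by
  change (frame p v * transMatrix r * (frame p v)⁻¹) • (geodesic p v s) = _
  rw [geodesic, geodesic, mul_smul, inv_smul_smul, mul_smul]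
  congr 1
  ext
  rw [coe_specialLinearGroup_apply]
  have h : Complex.exp (r / 2) * Complex.exp s / Complex.exp (-(r / 2)) =
      Complex.exp (s + r) := by
    rw [← Complex.exp_add, ← Complex.exp_sub]; congr 1; ring
  have hI (x : ℝ) : (⟨0, Real.exp x⟩ : ℂ) = Complex.exp x * Complex.I := by
    apply Complex.ext <;> simp [← Complex.ofReal_exp]
  simp only [hI, transMatrix]
  simp
  rw [← h]
  ring

end HypPlane

end

/-!
Put `t = p / q`. The product `A R` is a rotation by `2π / t = 2πq / p` about a point `z`, so, `p`
and `q` being coprime, its powers contain the rotation by `2π / p` about `z` up to the sign of a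
matrix. Conjugating by `R` gives a second rotation by `2π / p`, about `w = R z`. The value of `r_t`
makes `sin (π / t) cosh (d(z, w) / 2) = 1 / √2`, and `q > 1` makes `sin (π / p)` less than
`sin (π / t) / √2`; hence `2 sin (π / p) cosh (d(z, w) / 2) < 1`. Under this inequality the
iteration which replaces the centre `w` by the image of `z` under the rotation about `w` converges
to `z` without reaching it. The products of the rotations obtained in this way with the one about
`z` have angles tending to `4π / p` without reaching it, so their `p`-th powers are rotations by
arbitrarily small angles with centres tending to `z`. The closure of the group thus contains all
rotations about `z`, and, as it does not fix `z`, it is the whole group.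
-/

noncomputable section

namespace HypPlane

open UpperHalfPlane Filter Topology Real

section SpecialLinearGroup

theorem sl2_ext {M N : SL(2, ℝ)} (h00 : M 0 0 = N 0 0) (h01 : M 0 1 = N 0 1)
    (h10 : M 1 0 = N 1 0) (h11 : M 1 1 = N 1 1) : M = N := by
  ext i j
  fin_cases i <;> fin_cases j <;> assumption

theorem sl2_det (M : SL(2, ℝ)) : M 0 0 * M 1 1 - M 0 1 * M 1 0 = 1 := by
  rw [← Matrix.det_fin_two]
  exact M.det_coe

theorem sl2_mul_apply (M N : SL(2, ℝ)) (i j : Fin 2) :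
    (M * N) i j = M i 0 * N 0 j + M i 1 * N 1 j := by
  rw [Matrix.SpecialLinearGroup.coe_mul, Matrix.mul_apply, Fin.sum_univ_two]

theorem sl2_inv_apply (M : SL(2, ℝ)) :
    M⁻¹ 0 0 = M 1 1 ∧ M⁻¹ 0 1 = -M 0 1 ∧ M⁻¹ 1 0 = -M 1 0 ∧ M⁻¹ 1 1 = M 0 0 := by
  simp [Matrix.SpecialLinearGroup.SL2_inv_expl]

theorem continuous_sl2_apply (i j : Fin 2) : Continuous fun M : SL(2, ℝ) => M i j :=
  (continuous_apply_apply i j).comp continuous_subtype_val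

theorem smul_I_eq_I_iff (M : SL(2, ℝ)) : M • I = I ↔ M 0 0 = M 1 1 ∧ M 0 1 = -M 1 0 :=
  gl_smul_I_eq_I_iff_of_pos (g := (M : GL (Fin 2) ℝ)) (by simp)

end SpecialLinearGroup

section Rotations

theorem rotMatrix_apply (α : ℝ) :
    rotMatrix α 0 0 = cos (α / 2) ∧ rotMatrix α 0 1 = -sin (α / 2) ∧
      rotMatrix α 1 0 = sin (α / 2) ∧ rotMatrix α 1 1 = cos (α / 2) :=
  ⟨rfl, rfl, rfl, rfl⟩

theorem rotMatrix_add (α β : ℝ) : rotMatrix (α + β) = rotMatrix α * rotMatrix β := by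
  obtain ⟨h00, h01, h10, h11⟩ := rotMatrix_apply (α + β)
  obtain ⟨a00, a01, a10, a11⟩ := rotMatrix_apply α
  obtain ⟨b00, b01, b10, b11⟩ := rotMatrix_apply β
  apply sl2_ext <;> rw [sl2_mul_apply] <;>
    simp only [h00, h01, h10, h11, a00, a01, a10, a11, b00, b01, b10, b11, add_div, cos_add,
      sin_add] <;> ring

/-- The matrix of the clockwise rotation of angle `α` about `z`. It has period `4π` in `α`, while
the rotation itself has period `2π`. -/
def rotMatrixAt (z : ℍ) (α : ℝ) : SL(2, ℝ) := z.toSL2R * rotMatrix α * z.toSL2R⁻¹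

theorem moebius_rotMatrixAt (z : ℍ) (α : ℝ) : moebius (rotMatrixAt z α) = rotation z α := rfl

theorem rotMatrixAt_apply (z : ℍ) (α : ℝ) :
    rotMatrixAt z α 0 0 = cos (α / 2) + sin (α / 2) * z.re / z.im ∧
      rotMatrixAt z α 0 1 = -(sin (α / 2) * (z.re ^ 2 + z.im ^ 2) / z.im) ∧
      rotMatrixAt z α 1 0 = sin (α / 2) / z.im ∧
      rotMatrixAt z α 1 1 = cos (α / 2) - sin (α / 2) * z.re / z.im := by
  have hy : √z.im ^ 2 = z.im := sq_sqrt z.im_pos.le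
  have hy0 : √z.im ≠ 0 := (sqrt_pos.2 z.im_pos).ne'
  obtain ⟨i00, i01, i10, i11⟩ := sl2_inv_apply z.toSL2R
  obtain ⟨r00, r01, r10, r11⟩ := rotMatrix_apply α
  obtain ⟨m00, m01, m10, m11⟩ : z.toSL2R 0 0 = √z.im ∧ z.toSL2R 0 1 = z.re / √z.im ∧
      z.toSL2R 1 0 = 0 ∧ z.toSL2R 1 1 = 1 / √z.im := by
    simp [coe_toSL2R]
  refine ⟨?_, ?_, ?_, ?_⟩ <;> simp only [rotMatrixAt, sl2_mul_apply, i00, i01, i10, i11, r00, r01,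
    r10, r11, m00, m01, m10, m11] <;> field_simp <;> simp only [hy] <;> ring

theorem rotMatrixAt_add (z : ℍ) (α β : ℝ) :
    rotMatrixAt z (α + β) = rotMatrixAt z α * rotMatrixAt z β := by
  simp only [rotMatrixAt, rotMatrix_add]
  group

theorem rotMatrixAt_zpow (z : ℍ) (α : ℝ) (m : ℤ) : rotMatrixAt z α ^ m = rotMatrixAt z (m * α) := by
  let f : Multiplicative ℝ →* SL(2, ℝ) :=
    MonoidHom.mk' (fun α => rotMatrixAt z α.toAdd) fun _ _ => rotMatrixAt_add z _ _
  have h := (map_zpow f (Multiplicative.ofAdd α) m).symm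
  rwa [← ofAdd_zsmul, zsmul_eq_mul] at h

theorem rotMatrixAt_zero (z : ℍ) : rotMatrixAt z 0 = 1 := by
  simpa using (rotMatrixAt_zpow z 0 0).symm

theorem rotMatrixAt_two_pi (z : ℍ) : rotMatrixAt z (2 * π) = -1 := by
  obtain ⟨h00, h01, h10, h11⟩ := rotMatrixAt_apply z (2 * π)
  apply sl2_ext <;> simp [*]

theorem rotMatrixAt_add_int_mul_four_pi (z : ℍ) (α : ℝ) (m : ℤ) :
    rotMatrixAt z (α + m * (4 * π)) = rotMatrixAt z α := by
  rw [rotMatrixAt_add, ← rotMatrixAt_zpow, show 4 * π = 2 * π + 2 * π by ring, rotMatrixAt_add,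
    rotMatrixAt_two_pi, neg_mul_neg, one_mul, one_zpow, mul_one]

theorem continuous_rotMatrix : Continuous rotMatrix := by
  refine continuous_induced_rng.2 (continuous_matrix fun i j => ?_)
  fin_cases i <;> fin_cases j <;> simp only [Fin.zero_eta, Fin.mk_one, Fin.isValue] <;> fun_prop

theorem continuous_rotMatrixAt : Continuous fun p : ℍ × ℝ => rotMatrixAt p.1 p.2 :=
  have hz : Continuous fun p : ℍ × ℝ => p.1.toSL2R := continuous_toSL2R.comp continuous_fst
  (hz.mul (continuous_rotMatrix.comp continuous_snd)).mul hz.inv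

theorem rotMatrixAt_I (α : ℝ) : rotMatrixAt I α = rotMatrix α := by
  obtain ⟨h00, h01, h10, h11⟩ := rotMatrixAt_apply I α
  apply sl2_ext <;> simp [*, rotMatrix]

theorem rotMatrixAt_smul_self (z : ℍ) (α : ℝ) : rotMatrixAt z α • z = z :=
  rotation_apply_self z α

theorem exists_eq_rotMatrix_of_smul_I {M : SL(2, ℝ)} (hM : M • I = I) : ∃ φ, M = rotMatrix φ := by
  obtain ⟨h00, h01⟩ := (smul_I_eq_I_iff M).1 hM
  have hnorm : ‖(⟨M 1 1, M 1 0⟩ : ℂ)‖ = 1 := by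
    rw [← sq_eq_sq₀ (norm_nonneg _) zero_le_one, Complex.sq_norm, Complex.normSq_apply]
    linear_combination sl2_det M - M 1 1 * h00 + M 1 0 * h01
  obtain ⟨θ, -, hθ⟩ := Complex.norm_eq_one_iff'.1 hnorm
  rw [Complex.ext_iff, Complex.exp_ofReal_mul_I_re, Complex.exp_ofReal_mul_I_im] at hθ
  refine ⟨2 * θ, ?_⟩
  apply sl2_ext <;> simp [rotMatrix, *]

theorem exists_eq_rotMatrixAt_of_smul_eq {M : SL(2, ℝ)} {z : ℍ} (hM : M • z = z) :
    ∃ φ, M = rotMatrixAt z φ := by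
  have hI : (z.toSL2R⁻¹ * M * z.toSL2R) • I = I := by
    rw [mul_smul, mul_smul, toSL2R_smul_I, hM, inv_smul_eq_iff, toSL2R_smul_I]
  obtain ⟨φ, hφ⟩ := exists_eq_rotMatrix_of_smul_I hI
  refine ⟨φ, ?_⟩
  rw [rotMatrixAt, ← hφ]
  group

theorem conj_rotMatrixAt (M : SL(2, ℝ)) (z : ℍ) (α : ℝ) :
    M * rotMatrixAt z α * M⁻¹ = rotMatrixAt (M • z) α := by
  have hI : ((M • z).toSL2R⁻¹ * M * z.toSL2R) • I = I := by
    rw [mul_smul, mul_smul, toSL2R_smul_I, inv_smul_eq_iff, toSL2R_smul_I]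
  obtain ⟨φ, hφ⟩ := exists_eq_rotMatrix_of_smul_I hI
  have hM : M * z.toSL2R = (M • z).toSL2R * rotMatrix φ := by rw [← hφ]; group
  have hcomm : rotMatrix φ * rotMatrix α = rotMatrix α * rotMatrix φ := by
    rw [← rotMatrix_add, add_comm, rotMatrix_add]
  calc M * rotMatrixAt z α * M⁻¹
      = (M * z.toSL2R) * rotMatrix α * (M * z.toSL2R)⁻¹ := by rw [rotMatrixAt]; group
    _ = (M • z).toSL2R * (rotMatrix φ * rotMatrix α) * (rotMatrix φ)⁻¹ * (M • z).toSL2R⁻¹ := by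
      rw [hM]; group
    _ = rotMatrixAt (M • z) α := by rw [hcomm, rotMatrixAt]; group

end Rotations

section Distance

theorem cosh_dist_I_smul_I (M : SL(2, ℝ)) :
    cosh (dist I (M • I)) = (M 0 0 ^ 2 + M 0 1 ^ 2 + M 1 0 ^ 2 + M 1 1 ^ 2) / 2 := by
  have hdet := sl2_det M
  have hN : M 1 1 ^ 2 + M 1 0 ^ 2 ≠ 0 := by
    have h := normSq_denom_ne_zero (M : GL (Fin 2) ℝ) I.im_ne_zero
    simpa [Complex.normSq_apply, denom_SL, ← sq] using h
  have hcoe : ((M • I : ℍ) : ℂ) = (⟨M 0 1, M 0 0⟩ : ℂ) / ⟨M 1 1, M 1 0⟩ := by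
    rw [coe_specialLinearGroup_apply]
    congr 1 <;> apply Complex.ext <;> simp
  have hre : (M • I).re = (M 0 0 * M 1 0 + M 0 1 * M 1 1) / (M 1 1 ^ 2 + M 1 0 ^ 2) := by
    rw [← coe_re, hcoe, Complex.div_re, Complex.normSq_mk, ← sq, ← sq]
    ring
  have him : (M • I).im = 1 / (M 1 1 ^ 2 + M 1 0 ^ 2) := by
    rw [← coe_im, hcoe, Complex.div_im, Complex.normSq_mk, ← sq, ← sq]
    linear_combination hdet / (M 1 1 ^ 2 + M 1 0 ^ 2)
  rw [cosh_dist', hre, him, I_re, I_im]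
  field_simp
  linear_combination -(M 0 0 * M 1 1 - M 0 1 * M 1 0 + 1) * hdet

theorem cosh_dist_rotMatrixAt_smul_I (z : ℍ) (α : ℝ) :
    cosh (dist I (rotMatrixAt z α • I)) = 1 + 2 * (sin (α / 2) * sinh (dist z I)) ^ 2 := by
  obtain ⟨h00, h01, h10, h11⟩ := rotMatrixAt_apply z α
  rw [cosh_dist_I_smul_I, h00, h01, h10, h11, mul_pow, sinh_sq, cosh_dist', I_re, I_im]
  field_simp
  linear_combination 2 * z.im ^ 2 * sin_sq_add_cos_sq (α / 2)

theorem sinh_half_dist_rotMatrixAt_smul (z w : ℍ) (α : ℝ) :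
    sinh (dist w (rotMatrixAt z α • w) / 2) = |sin (α / 2)| * sinh (dist z w) := by
  let M := w.toSL2R
  have hw : M • I = w := toSL2R_smul_I w
  have hz : M • (M⁻¹ • z) = z := smul_inv_smul M z
  have hD : dist w (rotMatrixAt z α • w) = dist I (rotMatrixAt (M⁻¹ • z) α • I) := by
    rw [← dist_smul M I, ← mul_smul, ← hw, ← mul_smul, ← hz, ← conj_rotMatrixAt, hz]
    group
  have hd : dist z w = dist (M⁻¹ • z) I := by rw [← dist_smul M _ I, hw, hz]
  have hcosh := cosh_dist_rotMatrixAt_smul_I (M⁻¹ • z) α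
  rw [← hD, ← hd, ← mul_div_cancel₀ (dist w _) two_ne_zero, cosh_two_mul, cosh_sq] at hcosh
  have hsq : sinh (dist w (rotMatrixAt z α • w) / 2) ^ 2 =
      (|sin (α / 2)| * sinh (dist z w)) ^ 2 := by
    rw [mul_pow, sq_abs]
    linear_combination hcosh / 2
  refine (pow_left_inj₀ ?_ ?_ two_ne_zero).1 hsq
  · exact sinh_nonneg_iff.2 (by positivity)
  · exact mul_nonneg (abs_nonneg _) (sinh_nonneg_iff.2 dist_nonneg)

theorem rotMatrix_pi_smul (w : ℍ) : ((rotMatrix π • w : ℍ) : ℂ) = -(w : ℂ)⁻¹ := by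
  rw [coe_specialLinearGroup_apply]
  simp [rotMatrix, neg_div]

theorem exists_rotMatrix_smul_re_eq_zero (w : ℍ) : ∃ α, (rotMatrix α • w).re = 0 := by
  have hcont : Continuous fun α => (rotMatrix α • w).re :=
    continuous_re.comp (continuous_rotMatrix.smul continuous_const)
  have h0 : (rotMatrix 0 • w).re = w.re := by
    rw [← rotMatrixAt_I, rotMatrixAt_zero, one_smul]
  have hπ : (rotMatrix π • w).re = -(w.re / Complex.normSq w) := by
    rw [← coe_re, rotMatrix_pi_smul, Complex.neg_re, Complex.inv_re, coe_re]
  have hmem : (0 : ℝ) ∈ Set.uIcc (rotMatrix 0 • w).re (rotMatrix π • w).re := by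
    have hw := Complex.normSq_nonneg (w : ℂ)
    rw [h0, hπ, Set.mem_uIcc]
    rcases le_total w.re 0 with h | h
    · exact .inl ⟨h, neg_nonneg.2 (div_nonpos_of_nonpos_of_nonneg h hw)⟩
    · exact .inr ⟨neg_nonpos.2 (div_nonneg h hw), h⟩
  obtain ⟨α, -, hα⟩ := intermediate_value_uIcc hcont.continuousOn hmem
  exact ⟨α, hα⟩

theorem exists_rotMatrix_smul_eq_of_re_eq_zero {w w' : ℍ} (hw : w.re = 0) (hw' : w'.re = 0)
    (h : dist I w = dist I w') : ∃ α, rotMatrix α • w = w' := by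
  rw [dist_of_re_eq (by rw [I_re, hw]), dist_of_re_eq (by rw [I_re, hw']), I_im, log_one,
    dist_zero_left, dist_zero_left, norm_eq_abs, norm_eq_abs, abs_eq_abs] at h
  rcases h with h | h
  · have him := log_injOn_pos w.im_pos w'.im_pos h
    refine ⟨0, ?_⟩
    rw [← rotMatrixAt_I, rotMatrixAt_zero, one_smul]
    exact UpperHalfPlane.ext (Complex.ext (hw.trans hw'.symm) him)
  · rw [← log_inv] at h
    have him := log_injOn_pos w.im_pos (inv_pos.2 w'.im_pos) h
    refine ⟨π, UpperHalfPlane.ext ?_⟩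
    have hz : (w : ℂ) = w'.im⁻¹ * Complex.I := by
      apply Complex.ext <;> simp [hw, him]
    rw [rotMatrix_pi_smul, hz]
    apply Complex.ext <;> simp [hw']

theorem exists_rotMatrixAt_smul_eq {z w w' : ℍ} (h : dist z w = dist z w') :
    ∃ α, rotMatrixAt z α • w = w' := by
  let M := z.toSL2R
  have hdist (u : ℍ) (α : ℝ) : dist I (rotMatrix α • M⁻¹ • u) = dist z u := by
    rw [← toSL2R_smul_I z, ← rotMatrix_smul_I α, dist_smul, ← dist_smul M, smul_inv_smul,
      rotMatrix_smul_I]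
  obtain ⟨α, hα⟩ := exists_rotMatrix_smul_re_eq_zero (M⁻¹ • w)
  obtain ⟨α', hα'⟩ := exists_rotMatrix_smul_re_eq_zero (M⁻¹ • w')
  obtain ⟨β, hβ⟩ := exists_rotMatrix_smul_eq_of_re_eq_zero hα hα' (by rw [hdist, hdist, h])
  refine ⟨-α' + (β + α), ?_⟩
  have hinv : rotMatrix (-α') * rotMatrix α' = 1 := by
    rw [← rotMatrix_add, neg_add_cancel, ← rotMatrixAt_I, rotMatrixAt_zero]
  rw [rotMatrixAt, mul_smul, mul_smul, ← eq_inv_smul_iff, rotMatrix_add, rotMatrix_add, mul_smul,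
    mul_smul, hβ, ← mul_smul, hinv, one_smul]

end Distance

section Trace

theorem trace_rotMatrixAt (z : ℍ) (α : ℝ) : (rotMatrixAt z α).val.trace = 2 * cos (α / 2) := by
  obtain ⟨h00, -, -, h11⟩ := rotMatrixAt_apply z α
  rw [Matrix.trace_fin_two, h00, h11]
  ring

theorem trace_rotMatrixAt_mul_rotMatrixAt (z w : ℍ) (α β : ℝ) :
    (rotMatrixAt z α * rotMatrixAt w β).val.trace =
      2 * cos (α / 2) * cos (β / 2) - 2 * sin (α / 2) * sin (β / 2) * cosh (dist z w) := by
  obtain ⟨z00, z01, z10, z11⟩ := rotMatrixAt_apply z α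
  obtain ⟨w00, w01, w10, w11⟩ := rotMatrixAt_apply w β
  rw [Matrix.trace_fin_two, sl2_mul_apply, sl2_mul_apply, z00, z01, z10, z11, w00, w01, w10, w11,
    cosh_dist']
  field_simp
  ring

theorem exists_eq_rotMatrixAt_of_trace_eq {M : SL(2, ℝ)} {θ : ℝ} (hc : 0 < M 1 0)
    (hθ : 0 < sin (θ / 2)) (htr : M.val.trace = 2 * cos (θ / 2)) : ∃ z, M = rotMatrixAt z θ := by
  let z : ℍ := ⟨⟨(M 0 0 - M 1 1) / (2 * M 1 0), sin (θ / 2) / M 1 0⟩, div_pos hθ hc⟩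
  have hre : z.re = (M 0 0 - M 1 1) / (2 * M 1 0) := rfl
  have him : z.im = sin (θ / 2) / M 1 0 := rfl
  obtain ⟨h00, h01, h10, h11⟩ := rotMatrixAt_apply z θ
  simp only [hre, him] at h00 h01 h10 h11
  rw [Matrix.trace_fin_two] at htr
  have hdet := sl2_det M
  have hsq := sin_sq_add_cos_sq (θ / 2)
  refine ⟨z, sl2_ext ?_ ?_ ?_ ?_⟩
  · rw [h00]
    field_simp
    linear_combination htr
  · rw [h01]
    field_simp
    linear_combination (M 0 0 + M 1 1 + 2 * cos (θ / 2)) * htr - 4 * hdet + 4 * hsq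
  · rw [h10]
    field_simp
  · rw [h11]
    field_simp
    linear_combination htr

theorem tendsto_of_tendsto_rotMatrixAt {ι : Type*} {l : Filter ι} {z : ι → ℍ} {θ : ι → ℝ} {z₀ : ℍ}
    {θ₀ : ℝ} (hθ₀ : sin (θ₀ / 2) ≠ 0) (hθ : Tendsto θ l (𝓝 θ₀))
    (h : Tendsto (fun n => rotMatrixAt (z n) (θ n)) l (𝓝 (rotMatrixAt z₀ θ₀))) :
    Tendsto z l (𝓝 z₀) := by
  have hcoe {w : ℍ} {α : ℝ} (hα : sin (α / 2) ≠ 0) : (w : ℂ) =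
      ((rotMatrixAt w α 0 0 - rotMatrixAt w α 1 1) / 2 + sin (α / 2) * Complex.I) /
        rotMatrixAt w α 1 0 := by
    obtain ⟨h00, -, h10, h11⟩ := rotMatrixAt_apply w α
    have hw : (w.im : ℂ) ≠ 0 := Complex.ofReal_ne_zero.2 w.im_ne_zero
    have hs : (sin (α / 2) : ℂ) ≠ 0 := Complex.ofReal_ne_zero.2 hα
    rw [h00, h10, h11, ← Complex.re_add_im w, coe_re, coe_im]
    push_cast at hs ⊢
    field_simp
    ring
  have hsin : Tendsto (fun n => sin (θ n / 2)) l (𝓝 (sin (θ₀ / 2))) :=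
    (continuous_sin.tendsto _).comp (hθ.div_const 2)
  have hentry (i j) : Tendsto (fun n => (rotMatrixAt (z n) (θ n) i j : ℂ)) l
      (𝓝 (rotMatrixAt z₀ θ₀ i j : ℂ)) :=
    (Complex.continuous_ofReal.tendsto _).comp (((continuous_sl2_apply i j).tendsto _).comp h)
  have h10 : (rotMatrixAt z₀ θ₀ 1 0 : ℂ) ≠ 0 := by
    rw [(rotMatrixAt_apply z₀ θ₀).2.2.1]
    exact Complex.ofReal_ne_zero.2 (div_ne_zero hθ₀ z₀.im_ne_zero)
  rw [isEmbedding_coe.tendsto_nhds_iff, hcoe hθ₀]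
  refine Tendsto.congr' ?_ <| ((((hentry 0 0).sub (hentry 1 1)).div_const 2).add
    (((Complex.continuous_ofReal.tendsto _).comp hsin).mul_const Complex.I)).div (hentry 1 0) h10
  filter_upwards [hsin.eventually_ne hθ₀] with n hn using (hcoe hn).symm

end Trace

theorem exists_tendsto_of_tendsto_rotMatrixAt {ι : Type*} {l : Filter ι} {M : ι → SL(2, ℝ)}
    {z₀ : ℍ} {θ₀ : ℝ} (hθ₀ : θ₀ ∈ Set.Ioo 0 (2 * π))
    (hM : Tendsto M l (𝓝 (rotMatrixAt z₀ θ₀))) :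
    ∃ (z : ι → ℍ) (θ : ι → ℝ), Tendsto z l (𝓝 z₀) ∧ Tendsto θ l (𝓝 θ₀) ∧
      ∀ᶠ n in l, M n = rotMatrixAt (z n) (θ n) := by
  have hmem : θ₀ / 2 ∈ Set.Ioo 0 π := ⟨by linarith [hθ₀.1], by linarith [hθ₀.2]⟩
  have hsin : 0 < sin (θ₀ / 2) := sin_pos_of_mem_Ioo hmem
  have hcos : cos (θ₀ / 2) ∈ Set.Ioo (-1) 1 := by
    rw [Set.mem_Ioo, ← abs_lt, ← sq_lt_one_iff_abs_lt_one, cos_sq']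
    exact sub_lt_self _ (pow_pos hsin 2)
  have htr : Tendsto (fun n => (M n).val.trace / 2) l (𝓝 (cos (θ₀ / 2))) := by
    have h := ((continuous_subtype_val.matrix_trace.tendsto _).comp hM).div_const 2
    rwa [trace_rotMatrixAt, mul_div_cancel_left₀ _ two_ne_zero] at h
  have h10 : ∀ᶠ n in l, 0 < M n 1 0 := by
    refine (((continuous_sl2_apply 1 0).tendsto _).comp hM).eventually_const_lt ?_
    rw [(rotMatrixAt_apply z₀ θ₀).2.2.1]
    exact div_pos hsin z₀.im_pos
  let θ n := 2 * arccos ((M n).val.trace / 2)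
  have hθ : Tendsto θ l (𝓝 θ₀) := by
    have h := ((continuous_arccos.tendsto _).comp htr).const_mul 2
    rwa [arccos_cos hmem.1.le hmem.2.le, mul_div_cancel₀ _ two_ne_zero] at h
  have hex : ∀ᶠ n in l, ∃ z, M n = rotMatrixAt z (θ n) := by
    filter_upwards [htr.eventually (Ioo_mem_nhds hcos.1 hcos.2), h10] with n hn hn10
    have hhalf : θ n / 2 = arccos ((M n).val.trace / 2) := mul_div_cancel_left₀ _ two_ne_zero
    apply exists_eq_rotMatrixAt_of_trace_eq hn10
    · rw [hhalf, sin_arccos]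
      exact sqrt_pos.2 (sub_pos.2 ((sq_lt_one_iff_abs_lt_one _).2 (abs_lt.2 hn)))
    · rw [hhalf, cos_arccos hn.1.le hn.2.le, mul_div_cancel₀ _ two_ne_zero]
  let z n := Classical.epsilon fun z => M n = rotMatrixAt z (θ n)
  have hz : ∀ᶠ n in l, M n = rotMatrixAt (z n) (θ n) := hex.mono fun n => Classical.epsilon_spec
  exact ⟨z, θ, tendsto_of_tendsto_rotMatrixAt hsin.ne' hθ (hM.congr' hz), hθ, hz⟩

section ClosedSubgroups

variable {ι : Type*} {l : Filter ι} {H : Subgroup SL(2, ℝ)}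

theorem tendsto_round_div_mul {ε : ι → ℝ} (hε : Tendsto ε l (𝓝 0))
    (hε0 : ∀ᶠ n in l, ε n ≠ 0) (φ : ℝ) :
    Tendsto (fun n => round (φ / ε n) * ε n) l (𝓝 φ) := by
  refine tendsto_iff_dist_tendsto_zero.2 (squeeze_zero' (.of_forall fun _ => dist_nonneg) ?_
    (tendsto_zero_iff_norm_tendsto_zero.1 hε))
  filter_upwards [hε0] with n hn
  calc dist (round (φ / ε n) * ε n) φ
      = |φ / ε n - round (φ / ε n)| * |ε n| := by
        rw [dist_comm, Real.dist_eq, ← abs_mul, sub_mul, div_mul_cancel₀ _ hn]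
    _ ≤ 1 * ‖ε n‖ := by
        gcongr
        · exact (abs_sub_round _).trans one_half_lt_one.le
        · exact (norm_eq_abs _).ge
    _ = ‖ε n‖ := one_mul _

theorem rotMatrixAt_mem_of_tendsto_zero [l.NeBot] (hH : IsClosed (H : Set SL(2, ℝ))) {z : ι → ℍ}
    {z₀ : ℍ} {ε : ι → ℝ} (hz : Tendsto z l (𝓝 z₀)) (hε : Tendsto ε l (𝓝 0))
    (hε0 : ∀ᶠ n in l, ε n ≠ 0) (hmem : ∀ᶠ n in l, rotMatrixAt (z n) (ε n) ∈ H) (φ : ℝ) :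
    rotMatrixAt z₀ φ ∈ H := by
  refine hH.mem_of_tendsto ((continuous_rotMatrixAt.tendsto (z₀, φ)).comp
    (hz.prodMk_nhds (tendsto_round_div_mul hε hε0 φ))) ?_
  filter_upwards [hmem] with n hn
  have hpow := H.zpow_mem hn (round (φ / ε n))
  rwa [rotMatrixAt_zpow] at hpow

theorem rotMatrixAt_mem_of_tendsto [l.NeBot] (hH : IsClosed (H : Set SL(2, ℝ))) {M : ι → SL(2, ℝ)}
    {z₀ : ℍ} {θ₀ : ℝ} (hθ₀ : θ₀ ∈ Set.Ioo 0 (2 * π)) {N j : ℤ} (hN : N ≠ 0)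
    (hNθ₀ : N * θ₀ = j * (4 * π)) (hM : Tendsto M l (𝓝 (rotMatrixAt z₀ θ₀)))
    (hmem : ∀ n, M n ∈ H) (htr : ∀ n, (M n).val.trace ≠ 2 * cos (θ₀ / 2)) (φ : ℝ) :
    rotMatrixAt z₀ φ ∈ H := by
  obtain ⟨z, θ, hz, hθ, hMz⟩ := exists_tendsto_of_tendsto_rotMatrixAt hθ₀ hM
  have hpow (n : ι) : rotMatrixAt (z n) (N * (θ n - θ₀)) = rotMatrixAt (z n) (θ n) ^ N := by
    rw [mul_sub, hNθ₀, sub_eq_add_neg, ← neg_mul, ← Int.cast_neg, rotMatrixAt_add_int_mul_four_pi,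
      rotMatrixAt_zpow]
  refine rotMatrixAt_mem_of_tendsto_zero hH (ε := fun n => N * (θ n - θ₀)) hz ?_ ?_ ?_ φ
  · simpa using (hθ.sub_const θ₀).const_mul (N : ℝ)
  · filter_upwards [hMz] with n hn
    refine mul_ne_zero (Int.cast_ne_zero.2 hN) (sub_ne_zero.2 fun h => htr n ?_)
    rw [hn, h, trace_rotMatrixAt]
  · filter_upwards [hMz] with n hn
    rw [hpow, ← hn]
    exact H.zpow_mem (hmem n) N

theorem sinh_half_dist_rotMatrixAt_smul_self (z w : ℍ) (α : ℝ) :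
    sinh (dist z (rotMatrixAt w α • z) / 2) =
      2 * |sin (α / 2)| * cosh (dist z w / 2) * sinh (dist z w / 2) := by
  rw [sinh_half_dist_rotMatrixAt_smul, dist_comm, ← mul_div_cancel₀ (dist z w) two_ne_zero,
    sinh_two_mul, mul_div_cancel₀ _ two_ne_zero]
  ring

theorem rotMatrixAt_smul_ne {z w : ℍ} {α : ℝ} (hα : sin (α / 2) ≠ 0) (hwz : w ≠ z) :
    rotMatrixAt w α • z ≠ z := by
  intro h
  have hd := sinh_half_dist_rotMatrixAt_smul w z α
  rw [h, dist_self, zero_div, sinh_zero, zero_eq_mul, abs_eq_zero, sinh_eq_zero, dist_eq_zero] at hd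
  exact hd.elim hα hwz

theorem tendsto_iterate_rotMatrixAt_smul {z w : ℍ} {α : ℝ}
    (hd : 2 * |sin (α / 2)| * cosh (dist z w / 2) < 1) :
    Tendsto (fun n => (fun v => rotMatrixAt v α • z)^[n] w) atTop (𝓝 z) := by
  set u : ℕ → ℍ := fun n => (fun v => rotMatrixAt v α • z)^[n] w
  set q := 2 * |sin (α / 2)| * cosh (dist z w / 2)
  have hq0 : 0 ≤ q := mul_nonneg (by positivity) (cosh_pos _).le
  have hs (v : ℍ) : 0 ≤ sinh (dist z v / 2) := sinh_nonneg_iff.2 (by positivity)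
  have hdecay (n : ℕ) : sinh (dist z (u n) / 2) ≤ q ^ n * sinh (dist z w / 2) := by
    induction n with
    | zero => rw [pow_zero, one_mul]; exact le_rfl
    | succ n ih =>
      have hle : dist z (u n) / 2 ≤ dist z w / 2 :=
        sinh_le_sinh.1 (ih.trans (mul_le_of_le_one_left (hs w) (pow_le_one₀ hq0 hd.le)))
      have hcosh : cosh (dist z (u n) / 2) ≤ cosh (dist z w / 2) :=
        cosh_le_cosh.2 (abs_le_abs_of_nonneg (by positivity) hle)
      have hsucc : u (n + 1) = rotMatrixAt (u n) α • z := Function.iterate_succ_apply' _ _ _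
      rw [hsucc, sinh_half_dist_rotMatrixAt_smul_self, pow_succ', mul_assoc q]
      exact mul_le_mul (mul_le_mul_of_nonneg_left hcosh (by positivity)) ih (hs _) hq0
  have hlim : Tendsto (fun n => 2 * (q ^ n * sinh (dist z w / 2))) atTop (𝓝 0) := by
    simpa using ((tendsto_pow_atTop_nhds_zero_of_lt_one hq0 hd).mul_const _).const_mul 2
  refine tendsto_iff_dist_tendsto_zero.2 (squeeze_zero (fun _ => dist_nonneg) (fun n => ?_) hlim)
  have hself := self_le_sinh_iff.2 (by positivity : 0 ≤ dist z (u n) / 2)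
  rw [dist_comm]
  linarith [hdecay n]

/-- Conjugating the rotation about `z` by the rotation about `v` gives the rotation about
`rotMatrixAt v α • z`, which is nearer to `z` than `v` is. -/
theorem exists_tendsto_rotMatrixAt_mem {z w : ℍ} {α : ℝ} (hα : sin (α / 2) ≠ 0)
    (hz : rotMatrixAt z α ∈ H) (hw : rotMatrixAt w α ∈ H) (hwz : w ≠ z)
    (hd : 2 * |sin (α / 2)| * cosh (dist z w / 2) < 1) :
    ∃ u : ℕ → ℍ, Tendsto u atTop (𝓝 z) ∧ ∀ n, u n ≠ z ∧ rotMatrixAt (u n) α ∈ H := by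
  refine ⟨_, tendsto_iterate_rotMatrixAt_smul hd, fun n => ?_⟩
  induction n with
  | zero => exact ⟨hwz, hw⟩
  | succ n ih =>
    rw [Function.iterate_succ_apply', ← conj_rotMatrixAt]
    exact ⟨rotMatrixAt_smul_ne hα ih.1, H.mul_mem (H.mul_mem ih.2 hz) (H.inv_mem ih.2)⟩

end ClosedSubgroups

section DenseSubgroups

variable {H : Subgroup SL(2, ℝ)} {z : ℍ}

theorem dist_rotMatrixAt_pi_smul (z w : ℍ) : dist z (rotMatrixAt w π • z) = 2 * dist z w := by
  have h := sinh_half_dist_rotMatrixAt_smul w z π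
  rw [sin_pi_div_two, abs_one, one_mul, sinh_inj, dist_comm w] at h
  linarith

theorem exists_mem_smul_eq_of_dist_le (hz : ∀ φ, rotMatrixAt z φ ∈ H) {M : SL(2, ℝ)} (hM : M ∈ H)
    {w : ℍ} (hw : dist z w ≤ 2 * dist z (M • z)) : ∃ N ∈ H, N • z = w := by
  have hcont : Continuous fun α => dist z (rotMatrixAt (M • z) α • z) :=
    continuous_const.dist ((continuous_rotMatrixAt.comp (.prodMk_right _)).smul continuous_const)
  have hIcc : dist z w ∈ Set.Icc (dist z (rotMatrixAt (M • z) 0 • z))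
      (dist z (rotMatrixAt (M • z) π • z)) := by
    rw [rotMatrixAt_zero, one_smul, dist_self, dist_rotMatrixAt_pi_smul]
    exact ⟨dist_nonneg, hw⟩
  obtain ⟨α, -, hα⟩ := intermediate_value_Icc pi_pos.le hcont.continuousOn hIcc
  obtain ⟨β, hβ⟩ := exists_rotMatrixAt_smul_eq hα
  refine ⟨rotMatrixAt z β * rotMatrixAt (M • z) α, H.mul_mem (hz β) ?_, by rw [mul_smul, hβ]⟩
  rw [← conj_rotMatrixAt]
  exact H.mul_mem (H.mul_mem hM (hz α)) (H.inv_mem hM)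

theorem exists_mem_dist_smul_eq (hz : rotMatrixAt z π ∈ H) {M : SL(2, ℝ)} (hM : M ∈ H) (n : ℕ) :
    ∃ N ∈ H, dist z (N • z) = 2 ^ n * dist z (M • z) := by
  induction n with
  | zero => exact ⟨M, hM, by rw [pow_zero, one_mul]⟩
  | succ n ih =>
    obtain ⟨N, hN, hd⟩ := ih
    refine ⟨N * rotMatrixAt z π * N⁻¹, H.mul_mem (H.mul_mem hN hz) (H.inv_mem hN), ?_⟩
    rw [conj_rotMatrixAt, dist_rotMatrixAt_pi_smul, hd, pow_succ']
    ring

theorem eq_top_of_rotMatrixAt_mem (hz : ∀ φ, rotMatrixAt z φ ∈ H) {M : SL(2, ℝ)} (hM : M ∈ H)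
    (hMz : M • z ≠ z) : H = ⊤ := by
  refine H.eq_top_iff'.2 fun K => ?_
  obtain ⟨n, hn⟩ := pow_unbounded_of_one_lt (dist z (K • z) / dist z (M • z)) one_lt_two
  obtain ⟨L, hL, hd⟩ := exists_mem_dist_smul_eq (hz π) hM n
  rw [div_lt_iff₀ (dist_pos.2 hMz.symm), ← hd] at hn
  obtain ⟨N, hN, hNK⟩ :=
    exists_mem_smul_eq_of_dist_le hz hL (hn.le.trans (le_mul_of_one_le_left dist_nonneg one_le_two))
  have hstab : (N⁻¹ * K) • z = z := by rw [mul_smul, inv_smul_eq_iff, hNK]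
  obtain ⟨φ, hφ⟩ := exists_eq_rotMatrixAt_of_smul_eq hstab
  rw [eq_mul_of_inv_mul_eq hφ]
  exact H.mul_mem hN (hz φ)

/-- A form of Jørgensen's inequality: two rotations of the same finite order about distinct but
close centres do not generate a discrete group. -/
theorem eq_top_of_two_mul_sin_mul_cosh_lt (hH : IsClosed (H : Set SL(2, ℝ))) {w : ℍ} {α : ℝ}
    (hα : α ∈ Set.Ioo 0 π) {N j : ℤ} (hN : N ≠ 0) (hNα : N * α = j * (2 * π))
    (hz : rotMatrixAt z α ∈ H) (hw : rotMatrixAt w α ∈ H) (hwz : w ≠ z)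
    (hd : 2 * sin (α / 2) * cosh (dist z w / 2) < 1) : H = ⊤ := by
  have hsin : 0 < sin (α / 2) :=
    sin_pos_of_pos_of_lt_pi (half_pos hα.1) ((half_lt_self hα.1).trans hα.2)
  rw [← abs_of_pos hsin] at hd
  obtain ⟨u, hu, huH⟩ := exists_tendsto_rotMatrixAt_mem hsin.ne' hz hw hwz hd
  have hlim : Tendsto (fun n => rotMatrixAt (u n) α * rotMatrixAt z α) atTop
      (𝓝 (rotMatrixAt z (2 * α))) := by
    rw [two_mul, rotMatrixAt_add]
    exact ((continuous_rotMatrixAt.tendsto (z, α)).comp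
      (hu.prodMk_nhds tendsto_const_nhds)).mul_const _
  have htr (n : ℕ) :
      (rotMatrixAt (u n) α * rotMatrixAt z α).val.trace ≠ 2 * cos (2 * α / 2) := by
    have hcosh : 1 < cosh (dist (u n) z) := one_lt_cosh.2 (dist_ne_zero.2 (huH n).1)
    have hlt := lt_mul_of_one_lt_right (pow_pos hsin 2) hcosh
    rw [trace_rotMatrixAt_mul_rotMatrixAt, mul_div_assoc, cos_two_mul']
    exact ne_of_lt (by linarith)
  have hfull := rotMatrixAt_mem_of_tendsto hH (θ₀ := 2 * α) (j := j)
    ⟨by linarith [hα.1], by linarith [hα.2]⟩ hN (by linear_combination 2 * hNα) hlim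
    (fun n => H.mul_mem (huH n).2 hz) htr
  exact eq_top_of_rotMatrixAt_mem hfull hw (rotMatrixAt_smul_ne hsin.ne' hwz)

end DenseSubgroups

section Surjectivity

theorem im_eq_and_sq_re_eq_of_dist_eq {z w u : ℍ} (hu : u.re = 0) (hu1 : u.im ≠ 1)
    (hI : dist z I = dist w I) (h : dist z u = dist w u) : z.im = w.im ∧ z.re ^ 2 = w.re ^ 2 := by
  have hw := w.im_ne_zero
  have hcI := congrArg cosh hI
  have hcu := congrArg cosh h
  rw [cosh_dist', cosh_dist', I_re, I_im] at hcI
  rw [cosh_dist', cosh_dist', hu] at hcu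
  field_simp at hcI hcu
  have hu2 : u.im ^ 2 - 1 ≠ 0 :=
    sub_ne_zero.2 fun h => hu1 ((pow_eq_one_iff_of_nonneg u.im_pos.le two_ne_zero).1 h)
  have him : z.im = w.im := mul_left_cancel₀ hu2 (by linear_combination hcI - hcu)
  refine ⟨him, mul_left_cancel₀ hw ?_⟩
  rw [him] at hcI
  linear_combination hcI

theorem J_smul_re (z : ℍ) : (J • z).re = -z.re := by
  rw [← coe_re, coe_J_smul, Complex.neg_re, Complex.conj_re, coe_re]

theorem J_smul_im (z : ℍ) : (J • z).im = z.im := by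
  rw [← coe_im, coe_J_smul, Complex.neg_im, Complex.conj_im, neg_neg, coe_im]

theorem dist_J_smul (z w : ℍ) : dist (J • z) (J • w) = dist z w := by
  rw [UpperHalfPlane.dist_eq, coe_J_smul, coe_J_smul, dist_neg_neg, Complex.dist_conj_conj,
    J_smul_im, J_smul_im, UpperHalfPlane.dist_eq]

theorem J_smul_eq_self {z : ℍ} (hz : z.re = 0) : J • z = z :=
  UpperHalfPlane.ext (Complex.ext (by rw [coe_re, J_smul_re, coe_re, hz, neg_zero]) (J_smul_im z))

theorem eq_or_eq_J_smul_of_dist_eq {z w u : ℍ} (hu : u.re = 0) (hu1 : u.im ≠ 1)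
    (hI : dist z I = dist w I) (h : dist z u = dist w u) : z = w ∨ z = J • w := by
  obtain ⟨him, hre⟩ := im_eq_and_sq_re_eq_of_dist_eq hu hu1 hI h
  refine (sq_eq_sq_iff_eq_or_eq_neg.1 hre).imp (fun hre => UpperHalfPlane.ext (Complex.ext hre him))
    fun hre => UpperHalfPlane.ext (Complex.ext ?_ ?_)
  · rw [coe_re, coe_re, J_smul_re, hre]
  · rw [coe_im, coe_im, J_smul_im, him]

theorem re_eq_of_dist_eq {z w u : ℍ} (hu : u.re ≠ 0) (him : z.im = w.im)
    (hre : z.re ^ 2 = w.re ^ 2) (h : dist z u = dist w u) : z.re = w.re := by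
  have hcu := congrArg cosh h
  rw [cosh_dist', cosh_dist', him] at hcu
  field_simp at hcu
  exact mul_left_cancel₀ hu (by linear_combination (hre - hcu) / 2)

theorem eq_of_dist_eq {z w u u' : ℍ} (hu : u.re = 0) (hu1 : u.im ≠ 1) (hu' : u'.re ≠ 0)
    (hI : dist z I = dist w I) (h : dist z u = dist w u) (h' : dist z u' = dist w u') : z = w := by
  obtain ⟨him, hre⟩ := im_eq_and_sq_re_eq_of_dist_eq hu hu1 hI h
  exact UpperHalfPlane.ext (Complex.ext (re_eq_of_dist_eq hu' him hre h') him)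

theorem isometry_eq_id_or_eq_J_smul {g : ℍ → ℍ} (hg : Isometry g) {u : ℍ} (hu : u.re = 0)
    (hu1 : u.im ≠ 1) (hgI : g I = I) (hgu : g u = u) : g = id ∨ g = (J • ·) := by
  let u' : ℍ := (1 : ℝ) +ᵥ I
  have hu' : u'.re ≠ 0 := by simp [u']
  have hdist {v : ℍ} (hv : g v = v) (z : ℍ) : dist (g z) v = dist z v := by
    rw [← hg.dist_eq z v, hv]
  have hdistJ {v : ℍ} (hv : v.re = 0) (z : ℍ) : dist (J • z) v = dist z v := by
    rw [← dist_J_smul z v, J_smul_eq_self hv]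
  rcases eq_or_eq_J_smul_of_dist_eq hu hu1 (hdist hgI u') (hdist hgu u') with h | h
  · exact .inl (funext fun z => eq_of_dist_eq hu hu1 hu' (hdist hgI z) (hdist hgu z) (hdist h z))
  · refine .inr (funext fun z => eq_of_dist_eq hu hu1 (u' := J • u') ?_ ?_ ?_ ?_)
    · rwa [J_smul_re, neg_ne_zero]
    · rw [hdist hgI, hdistJ I_re]
    · rw [hdist hgu, hdistJ hu]
    · rw [dist_J_smul, ← h, hg.dist_eq]

theorem not_orientationPreserving_J_smul : ¬OrientationPreserving (J • ·) := by
  intro h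
  have hpos := h I
  have hd : fderiv ℝ (inCoord (J • ·)) (I : ℂ) = smulFDeriv J I :=
    (hasStrictFDerivAt_smul J I).hasFDerivAt.fderiv
  rw [hd, det_smulFDeriv, det_J, denom_J] at hpos
  norm_num at hpos

theorem moebius_surjective : Function.Surjective moebius := by
  intro g
  let u : ℍ := (⟨2, two_pos⟩ : {x : ℝ // 0 < x}) • I
  let M := ((g : ℍ ≃ᵢ ℍ) I).toSL2R
  have hM : M • I = (g : ℍ ≃ᵢ ℍ) I := toSL2R_smul_I _
  have hd : dist I u = dist I (M⁻¹ • (g : ℍ ≃ᵢ ℍ) u) := by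
    rw [← dist_smul M I (M⁻¹ • _), hM, smul_inv_smul, (g : ℍ ≃ᵢ ℍ).dist_eq]
  obtain ⟨α, hα⟩ := exists_rotMatrixAt_smul_eq hd
  let N := M * rotMatrixAt I α
  let g' := (moebius N)⁻¹ * g
  have hI : (g' : ℍ ≃ᵢ ℍ) I = I := by
    change N⁻¹ • (g : ℍ ≃ᵢ ℍ) I = I
    rw [inv_smul_eq_iff, mul_smul, rotMatrixAt_smul_self, hM]
  have hu : (g' : ℍ ≃ᵢ ℍ) u = u := by
    change N⁻¹ • (g : ℍ ≃ᵢ ℍ) u = u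
    rw [inv_smul_eq_iff, mul_smul, hα, smul_inv_smul]
  have hure : u.re = 0 := by simp [u]
  have huim : u.im ≠ 1 := by simp [u]
  rcases isometry_eq_id_or_eq_J_smul (g' : ℍ ≃ᵢ ℍ).isometry hure huim hI hu with h | h
  · have hg' : g' = 1 := Subtype.ext (IsometryEquiv.ext (congrFun h))
    exact ⟨N, inv_mul_eq_one.1 hg'⟩
  · exact (not_orientationPreserving_J_smul (h ▸ g'.2)).elim

theorem continuous_moebius : Continuous moebius :=
  continuous_induced_rng.2 (continuous_pi fun _ => continuous_id.smul continuous_const)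

theorem dense_map_moebius {H : Subgroup SL(2, ℝ)} (hH : H.topologicalClosure = ⊤) :
    Dense (H.map moebius : Set IsomPlus) := by
  have hdense : Dense (H : Set SL(2, ℝ)) := by
    rw [dense_iff_closure_eq, ← Subgroup.topologicalClosure_coe, hH, Subgroup.coe_top]
  exact moebius_surjective.denseRange.dense_image continuous_moebius hdense

end Surjectivity

section RobotGroup

theorem cosh_half_sideLength {t : ℝ} (ht : 4 < t) : cosh (sideLength t / 2) = √2 * cos (π / t) := by
  have hlt : π / t < π / 4 := div_lt_div_of_pos_left pi_pos (by norm_num) ht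
  have h0 : 0 < π / t := by positivity
  have hcos : 0 < cos (π / t) := cos_pos_of_mem_Ioo ⟨by linarith, by linarith⟩
  have hcos2 : 0 < cos (2 * (π / t)) := cos_pos_of_mem_Ioo ⟨by linarith, by linarith⟩
  have hcosh : cosh (2 * (sideLength t / 2)) = 1 + 2 * cos (2 * (π / t)) := by
    rw [mul_div_cancel₀ _ two_ne_zero, sideLength, mul_div_assoc]
    exact cosh_arcosh (by linarith)
  rw [cosh_two_mul, sinh_sq, cos_two_mul] at hcosh
  refine (pow_left_inj₀ (cosh_pos _).le (by positivity) two_ne_zero).1 ?_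
  rw [mul_pow, sq_sqrt zero_le_two]
  linarith

theorem two_mul_sin_sq_lt {x y : ℝ} (hx : 0 < x) (hxy : 2 * x ≤ y) (hy : y < π / 2) :
    2 * sin x ^ 2 < sin y ^ 2 := by
  have hsin : 0 < sin x := sin_pos_of_pos_of_lt_pi hx (by linarith)
  have hcos : 0 < 2 * cos x ^ 2 - 1 := by
    rw [← cos_two_mul]
    exact cos_pos_of_mem_Ioo ⟨by linarith, by linarith⟩
  calc 2 * sin x ^ 2 < 2 * sin x ^ 2 + 2 * (sin x ^ 2 * (2 * cos x ^ 2 - 1)) := by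
        linarith [mul_pos (pow_pos hsin 2) hcos]
    _ = sin (2 * x) ^ 2 := by rw [sin_two_mul]; ring
    _ ≤ sin y ^ 2 := pow_le_pow_left₀ (sin_nonneg_of_nonneg_of_le_pi (by linarith) (by linarith))
        (sin_le_sin_of_le_of_le_pi_div_two (by linarith) hy.le hxy) 2

theorem trace_transMatrix (r : ℝ) : (transMatrix r).val.trace = 2 * cosh (r / 2) := by
  rw [transMatrix, Matrix.trace_fin_two_of, cosh_eq]
  ring

theorem trace_transMatrix_mul_rotMatrix (r α : ℝ) :
    (transMatrix r * rotMatrix α).val.trace = 2 * cosh (r / 2) * cos (α / 2) := by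
  rw [Matrix.SpecialLinearGroup.coe_mul, transMatrix, rotMatrix, Matrix.mul_fin_two,
    Matrix.trace_fin_two_of, cosh_eq]
  ring

theorem exists_transMatrix_mul_rotMatrix_eq {r τ : ℝ} (hτ : 0 < sin τ)
    (h : cosh (r / 2) = √2 * cos τ) :
    ∃ z, transMatrix r * rotMatrix (π / 2) = rotMatrixAt z (2 * τ) ∧
      sin τ * cosh (dist z I) = cos τ := by
  have hτ2 : 2 * τ / 2 = τ := mul_div_cancel_left₀ _ two_ne_zero
  have hπ : π / 2 / 2 = π / 4 := by ring
  have h2 : √2 ^ 2 = 2 := sq_sqrt zero_le_two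
  have hc : 0 < (transMatrix r * rotMatrix (π / 2)) 1 0 := by
    have h10 : (transMatrix r * rotMatrix (π / 2)) 1 0 = exp (-(r / 2)) * (√2 / 2) := by
      rw [sl2_mul_apply]
      simp [transMatrix, rotMatrix, hπ]
    rw [h10]
    positivity
  have htr : (transMatrix r * rotMatrix (π / 2)).val.trace = 2 * cos (2 * τ / 2) := by
    rw [trace_transMatrix_mul_rotMatrix, h, hπ, cos_pi_div_four, hτ2]
    linear_combination cos τ * h2
  obtain ⟨z, hz⟩ := exists_eq_rotMatrixAt_of_trace_eq hc (by rwa [hτ2]) htr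
  refine ⟨z, hz, ?_⟩
  have hA : rotMatrixAt z (2 * τ) * rotMatrixAt I (-(π / 2)) = transMatrix r := by
    rw [← hz, ← rotMatrixAt_I, mul_assoc, ← rotMatrixAt_add, add_neg_cancel, rotMatrixAt_zero,
      mul_one]
  have htrA := trace_rotMatrixAt_mul_rotMatrixAt z I (2 * τ) (-(π / 2))
  rw [hA, trace_transMatrix, h, hτ2, neg_div, hπ, cos_neg, sin_neg, cos_pi_div_four,
    sin_pi_div_four] at htrA
  exact mul_left_cancel₀ (sqrt_ne_zero'.2 two_pos) (by linear_combination -htrA)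

theorem exists_conj_transMatrix_mul_rotMatrixAt_eq (T : SL(2, ℝ)) {r τ : ℝ} (hτ : 0 < sin τ)
    (h : cosh (r / 2) = √2 * cos τ) :
    ∃ z, T * transMatrix r * T⁻¹ * rotMatrixAt (T • I) (π / 2) = rotMatrixAt z (2 * τ) ∧
      sin τ * cosh (dist z (T • I)) = cos τ := by
  obtain ⟨z, hz, hd⟩ := exists_transMatrix_mul_rotMatrix_eq hτ h
  refine ⟨T • z, ?_, by rwa [dist_smul]⟩
  rw [← conj_rotMatrixAt, ← conj_rotMatrixAt, ← hz, rotMatrixAt_I]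
  group

theorem two_mul_sin_mul_cosh_half_dist_sq {z w : ℍ} {τ : ℝ}
    (h : sin τ * cosh (dist z w) = cos τ) :
    2 * (sin τ * cosh (dist z (rotMatrixAt w (π / 2) • z) / 2)) ^ 2 = 1 := by
  have hπ : π / 2 / 2 = π / 4 := by ring
  have h2 : √2 ^ 2 = 2 := sq_sqrt zero_le_two
  rw [mul_pow, cosh_sq, sinh_half_dist_rotMatrixAt_smul, hπ, sin_pi_div_four, mul_pow, sq_abs,
    dist_comm, sinh_sq, div_pow, h2]
  linear_combination sin_sq_add_cos_sq τ + (sin τ * cosh (dist z w) + cos τ) * h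

variable {H : Subgroup SL(2, ℝ)} {z w : ℍ} {p q : ℕ}

theorem neg_one_mem_of_rotMatrixAt_mem (hw : rotMatrixAt w (π / 2) ∈ H) : -1 ∈ H := by
  have h4 := H.zpow_mem hw 4
  rwa [rotMatrixAt_zpow, show ((4 : ℤ) : ℝ) * (π / 2) = 2 * π by push_cast; ring,
    rotMatrixAt_two_pi] at h4

theorem rotMatrixAt_two_pi_div_mem (hpq : p.Coprime q) (hp : p ≠ 0) (hneg : -1 ∈ H)
    (hz : rotMatrixAt z (2 * (π * q / p)) ∈ H) : rotMatrixAt z (2 * π / p) ∈ H := by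
  have hbezout : (1 : ℝ) = p * (p.gcdA q : ℤ) + q * (p.gcdB q : ℤ) := by
    have h := Nat.gcd_eq_gcd_ab p q
    rw [hpq.gcd_eq_one] at h
    exact_mod_cast h
  have hp0 : (p : ℝ) ≠ 0 := Nat.cast_ne_zero.2 hp
  have hangle : 2 * π / p = p.gcdA q * (2 * π) + p.gcdB q * (2 * (π * q / p)) := by
    field_simp
    linear_combination hbezout
  rw [← rotMatrixAt_two_pi z] at hneg
  rw [hangle, rotMatrixAt_add, ← rotMatrixAt_zpow, ← rotMatrixAt_zpow]
  exact H.mul_mem (H.zpow_mem hneg _) (H.zpow_mem hz _)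

theorem eq_top_of_sin_mul_cosh_dist_eq (hH : IsClosed (H : Set SL(2, ℝ))) (hpq : p.Coprime q)
    (hq : 1 < q) (hlt : 4 * q < p) (hd : sin (π * q / p) * cosh (dist z w) = cos (π * q / p))
    (hz : rotMatrixAt z (2 * (π * q / p)) ∈ H) (hw : rotMatrixAt w (π / 2) ∈ H) : H = ⊤ := by
  set τ := π * q / p
  have hp0 : (0 : ℝ) < p := by exact_mod_cast (by omega : 0 < p)
  have hπp : 0 < π / p := by positivity
  have hτp : 2 * (π / p) ≤ π * q / p := by
    rw [mul_div_assoc', mul_comm 2 π]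
    gcongr
    exact_mod_cast hq
  have hτ : τ < π / 4 := by
    rw [div_lt_iff₀ hp0, div_mul_eq_mul_div, lt_div_iff₀ four_pos, mul_assoc]
    gcongr
    exact_mod_cast mul_comm q 4 ▸ hlt
  have hα : 2 * π / p / 2 = π / p := by ring
  have hsin := two_mul_sin_sq_lt hπp hτp (by linarith)
  have hcosh := two_mul_sin_mul_cosh_half_dist_sq hd
  set w' := rotMatrixAt w (π / 2) • z
  have hzp := rotMatrixAt_two_pi_div_mem hpq (by omega) (neg_one_mem_of_rotMatrixAt_mem hw) hz
  have hw'p : rotMatrixAt w' (2 * π / p) ∈ H := by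
    rw [← conj_rotMatrixAt]
    exact H.mul_mem (H.mul_mem hw hzp) (H.inv_mem hw)
  have hne : w' ≠ z := by
    intro h
    have hcos : 0 < cos (2 * τ) := cos_pos_of_mem_Ioo ⟨by linarith, by linarith⟩
    rw [h, dist_self, zero_div, cosh_zero, mul_one] at hcosh
    rw [cos_two_mul, cos_sq'] at hcos
    linarith
  refine eq_top_of_two_mul_sin_mul_cosh_lt hH (N := p) (j := 1) ⟨by positivity, by linarith⟩
    (by omega) (by push_cast; field_simp) hzp hw'p hne ?_
  rw [hα]
  refine lt_of_pow_lt_pow_left₀ 2 zero_le_one ?_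
  calc (2 * sin (π / p) * cosh (dist z w' / 2)) ^ 2
      = 2 * (2 * sin (π / p) ^ 2 * cosh (dist z w' / 2) ^ 2) := by ring
    _ < 2 * (sin τ ^ 2 * cosh (dist z w' / 2) ^ 2) := by gcongr
    _ = 1 ^ 2 := by rw [one_pow, ← hcosh, mul_pow]

theorem eq_top_of_conj_transMatrix_mem (hH : IsClosed (H : Set SL(2, ℝ))) (hpq : p.Coprime q)
    (hq : 1 < q) (ht : 4 < (p : ℝ) / q) {T : SL(2, ℝ)} (hR : rotMatrixAt (T • I) (π / 2) ∈ H)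
    (hA : T * transMatrix (sideLength (p / q)) * T⁻¹ ∈ H) : H = ⊤ := by
  have hq0 : (0 : ℝ) < q := by exact_mod_cast one_pos.trans hq
  have hlt : 4 * q < p := by exact_mod_cast (lt_div_iff₀ hq0).1 ht
  have hcosh := cosh_half_sideLength ht
  have hsin : 0 < sin (π / (p / q)) := sin_pos_of_pos_of_lt_pi (by positivity)
    (div_lt_self pi_pos (by linarith))
  obtain ⟨z, hz, hd⟩ := exists_conj_transMatrix_mul_rotMatrixAt_eq T hsin hcosh
  rw [div_div_eq_mul_div] at hz hd
  exact eq_top_of_sin_mul_cosh_dist_eq hH hpq hq hlt hd (hz ▸ H.mul_mem hA hR) hR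

theorem frame_smul_I (p : ℍ) (v : ℂ) : frame p v • I = p := by
  rw [frame, mul_smul, rotMatrix_smul_I, toSL2R_smul_I]

theorem robotGroup_eq_map_moebius (p : ℍ) (v : ℂ) (r : ℝ) :
    robotGroup p v r = (Subgroup.closure {rotMatrixAt p (π / 2),
      frame p v * transMatrix r * (frame p v)⁻¹}).map moebius := by
  rw [MonoidHom.map_closure, Set.image_pair, moebius_rotMatrixAt, robotGroup, translation]

end RobotGroup

end HypPlane

end

theorem mainTheorem5 (p₀ : ℍ) (v : ℂ) (hv : ‖v‖ = p₀.im) (p q : ℕ) (hpq : Nat.Coprime p q)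
    (hq : 1 < q) (ht : 4 < (p : ℝ) / (q : ℝ)) :
    Dense (HypPlane.robotGroup p₀ v (HypPlane.sideLength ((p : ℝ) / (q : ℝ))) :
      Set HypPlane.IsomPlus) := by
  rw [HypPlane.robotGroup_eq_map_moebius]
  refine HypPlane.dense_map_moebius
    (HypPlane.eq_top_of_conj_transMatrix_mem (T := HypPlane.frame p₀ v)
      (Subgroup.isClosed_topologicalClosure _) hpq hq ht ?_ ?_)
  · rw [HypPlane.frame_smul_I]
    exact Subgroup.le_topologicalClosure _ (Subgroup.subset_closure (Set.mem_insert _ _))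
  · exact Subgroup.le_topologicalClosure _
      (Subgroup.subset_closure (Set.mem_insert_of_mem _ (Set.mem_singleton _)))
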